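/- **Theorem.** For $N\ge 1$ spins $1/2$ let $\hat S_\pm=\sum_{k=1}^N \hat s_{k\pm}$ on $(\mathbb C^2)^{\otimes N}$, where $\hat s_{\pm}=\hat s_x\pm i\hat s_y$ and $\hat s_{x},\hat s_y$ are half the Pauli matrices. Let $a^\dagger,a$ be the creation and annihilation operators of one bosonic mode with number states $|n\rangle$, $n\ge 0$: $a|n\rangle=\sqrt n\,|n-1\rangle$, $a^\dagger|n\rangle=\sqrt{n+1}\,|n+1\rangle$. Let $f(x,y)=\sum_w c_w\,w(x,y)$ be a power series with complex coefficients in two non-commuting variables, the sum being over all words $w$ in $x,y$; write $p(w)$ and $q(w)$ for the numbers of letters $x$ and $y$ in $w$, and $|w|=p(w)+q(w)$. Suppose that $f$ is well-behaved in the following sense: 1. $\sum_w |c_w|\,r^{|w|}<\infty$ for every $r\ge 0$; 2. $\displaystyle\sum_{w:\,p(w)=q(w)} |c_w|\,\frac{p(w)!}{2^{p(w)}}<\infty$ (note that $\frac{n!}{2^n}=\frac2\pi\int_{\mathbb C}|z|^{2n}e^{-2|z|^2}\,d^2z$). (Every non-commutative polynomial is well-behaved, and so is $e^{-\beta(xy+yx)}$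 for $|\beta|<1$.) Let $\mathcal N f(a^\dagger,a)=\sum_w c_w\,(a^\dagger)^{p(w)}a^{q(w)}$ be the normal-ordered function, understood through its matrix elements $\langle m|\mathcal N f(a^\dagger,a)|n\rangle=\sum_w c_w\langle m|(a^\dagger)^{p(w)}a^{q(w)}|n\rangle$, and let the bosonic trace be $\mathrm{tr}\,A=\sum_n\langle n|A|n\rangle$. Then the series of $f(\hat S_+/\sqrt N,\hat S_- /\sqrt N)$ converges for every $N$, the series of the matrix elements of $\mathcal N f(a^\dagger,a)$ converge, the sum defining the trace on the right-hand side below converges absolutely, and $$\lim_{N\to\infty}2^{-N}\,\mathrm{tr}\,f\Bigl(\frac{\hat S_+}{\sqrt N},\frac{\hat S_-}{\sqrt N}\Bigr)=\frac{2}{\sqrt3}\,\mathrm{tr}\Bigl\{e^{-\ln 3\,(a^\dagger a+\frac12)}\,\mathcal N f(a^\dagger,a)\Bigr\}.$$ Moreover $\hat\rho=\frac{2}{\sqrt3}e^{-\ln3\,(a^\dagger a+\frac12)}$ is a normalized state, $\mathrm{tr}\,\hat\rho=1$ (the thermal state of the mode with $\hbar\omega/k_BT=\ln 3$), and its mean occupation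 is $\mathrm{tr}(\hat\rho\,a^\dagger a)=\frac12$. -/

import Mathlib

noncomputable section

namespace SpinBoson

/-! ### Functions of two non-commuting variables -/

/-- The two letters: `plus` stands for the raising variable (`S₊` or `a†`),
`minus` for the lowering variable (`S₋` or `a`). -/
inductive Letter
  | plus
  | minus
  deriving DecidableEq

/-- A monomial in two non-commuting variables. -/
abbrev Word := List Letter

namespace Word

/-- Substitution of `x` for `plus` and `y` for `minus`, keeping the order of the factors. -/
def eval {R : Type*} [Monoid R] (x y : R) (w : Word) : R :=
  (w.map (fun l => match l with
    | Letter.plus => x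
    | Letter.minus => y)).prod

/-- The number of raising letters. -/
def numPlus (w : Word) : ℕ := List.count Letter.plus w

/-- The number of lowering letters. -/
def numMinus (w : Word) : ℕ := List.count Letter.minus w

end Word

/-- A function `f(x, y) = ∑_w c_w w(x, y)` of two non-commuting variables, given by the
coefficients `c_w` of its power series. -/
abbrev NCSeries := Word → ℂ

namespace NCSeries

/-- Well-behaved functions: the series of `f` converges absolutely everywhere, and its terms with
equally many raising and lowering letters are absolutely summable with respect to the Gaussian
weight `(2/π) ∫ |z|^(2n) e^(-2|z|²) d²z = n!/2^n`. -/
structure WellBehaved (f : NCSeries) : Prop where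
  entire : ∀ r : ℝ, 0 ≤ r → Summable fun w : Word => ‖f w‖ * r ^ w.length
  gaussian : Summable fun w : Word =>
    if w.numPlus = w.numMinus then
      ‖f w‖ * ((w.numPlus.factorial : ℝ) / 2 ^ w.numPlus)
    else 0

/-- The terms of the series of `f(x, y)`. -/
def term {R : Type*} [Monoid R] [SMul ℂ R] (f : NCSeries) (x y : R) (w : Word) : R :=
  f w • w.eval x y

/-- The value `f(x, y)`. -/
def eval {R : Type*} [Monoid R] [SMul ℂ R] [AddCommMonoid R] [TopologicalSpace R]
    (f : NCSeries) (x y : R) : R :=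
  ∑' w : Word, f.term x y w

end NCSeries

/-! ### `N` spins 1/2 -/

/-- Operators on `(ℂ²)^{⊗N}`, as matrices in the product basis. -/
abbrev SpinOp (N : ℕ) := Matrix (Fin N → Fin 2) (Fin N → Fin 2) ℂ

/-- `s_x`, half the first Pauli matrix. -/
def spinX : Matrix (Fin 2) (Fin 2) ℂ := !![0, 1 / 2; 1 / 2, 0]

/-- `s_y`, half the second Pauli matrix. -/
def spinY : Matrix (Fin 2) (Fin 2) ℂ := !![0, -Complex.I / 2; Complex.I / 2, 0]

/-- `s₊ = s_x + i s_y`. -/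
def spinPlus : Matrix (Fin 2) (Fin 2) ℂ := spinX + Complex.I • spinY

/-- `s₋ = s_x - i s_y`. -/
def spinMinus : Matrix (Fin 2) (Fin 2) ℂ := spinX - Complex.I • spinY

/-- `1 ⊗ ⋯ ⊗ A ⊗ ⋯ ⊗ 1`, with `A` acting on the `k`-th spin. -/
def atSite {N : ℕ} (k : Fin N) (A : Matrix (Fin 2) (Fin 2) ℂ) : SpinOp N :=
  Matrix.of fun σ τ => A (σ k) (τ k) * ∏ j ∈ Finset.univ.erase k, if σ j = τ j then 1 else 0

/-- `S₊ = ∑ₖ s₊` over the sites. -/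
def totalPlus (N : ℕ) : SpinOp N := ∑ k : Fin N, atSite k spinPlus

/-- `S₋ = ∑ₖ s₋` over the sites. -/
def totalMinus (N : ℕ) : SpinOp N := ∑ k : Fin N, atSite k spinMinus

/-- `S₊ / √N`. -/
def scaledPlus (N : ℕ) : SpinOp N := ((√(N : ℝ) : ℝ) : ℂ)⁻¹ • totalPlus N

/-- `S₋ / √N`. -/
def scaledMinus (N : ℕ) : SpinOp N := ((√(N : ℝ) : ℝ) : ℂ)⁻¹ • totalMinus N

/-- The infinite temperature state `2^{-N} 1`. -/
def infiniteTemperatureState (N : ℕ) : SpinOp N := ((2 : ℂ) ^ N)⁻¹ • (1 : SpinOp N)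

/-! ### One bosonic mode -/

/-- The space of finite-particle vectors, with basis the number states `|n⟩ = single n 1`
(orthonormal in the Fock space `ℓ²(ℕ)`, in which it is dense). -/
abbrev FiniteParticle := ℕ →₀ ℂ

/-- `a |n⟩ = √n |n - 1⟩`, and `a |0⟩ = 0`. -/
def annihilation : Module.End ℂ FiniteParticle :=
  Finsupp.linearCombination ℂ fun n : ℕ => Finsupp.single (n - 1) ((√(n : ℝ) : ℝ) : ℂ)

/-- `a† |n⟩ = √(n + 1) |n + 1⟩`. -/
def creation : Module.End ℂ FiniteParticle :=
  Finsupp.linearCombination ℂ fun n : ℕ => Finsupp.single (n + 1) ((√((n : ℝ) + 1) : ℝ) : ℂ)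

/-- The number operator `a† a`. -/
def number : Module.End ℂ FiniteParticle := creation * annihilation

/-- The matrix elements `⟨m| T |n⟩` in the number basis. -/
def matrixElements (T : Module.End ℂ FiniteParticle) : Matrix ℕ ℕ ℂ :=
  Matrix.of fun m n => T (Finsupp.single n 1) m

/-- The matrix of `e^T = ∑ₖ T^k / k!` in the number basis. -/
def expMatrix (T : Module.End ℂ FiniteParticle) : Matrix ℕ ℕ ℂ :=
  Matrix.of fun m n => ∑' k : ℕ, ((k.factorial : ℂ))⁻¹ * matrixElements (T ^ k) m n

/-- The matrix of a product of operators, `⟨m| A B |n⟩ = ∑ₖ ⟨m| A |k⟩ ⟨k| B |n⟩`. -/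
def opMul (A B : Matrix ℕ ℕ ℂ) : Matrix ℕ ℕ ℂ :=
  Matrix.of fun m n => ∑' k : ℕ, A m k * B k n

/-- `tr A = ∑ₙ ⟨n| A |n⟩ = t`, the sum being absolutely convergent. -/
def HasTrace (A : Matrix ℕ ℕ ℂ) (t : ℂ) : Prop := HasSum (fun n : ℕ => A n n) t

/-- The normal ordering of a word: all `a†` to the left of all `a`, without using the
commutation relation. -/
def normalOrderWord (w : Word) : Module.End ℂ FiniteParticle :=
  creation ^ w.numPlus * annihilation ^ w.numMinus

/-- The terms of the series of `⟨m| 𝒩f(a†, a) |n⟩`. -/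
def normalOrderTerm (f : NCSeries) (m n : ℕ) (w : Word) : ℂ :=
  f w * matrixElements (normalOrderWord w) m n

/-- The matrix of `𝒩f(a†, a) = ∑_w c_w 𝒩w(a†, a)` in the number basis. -/
def normalOrder (f : NCSeries) : Matrix ℕ ℕ ℂ :=
  Matrix.of fun m n => ∑' w : Word, normalOrderTerm f m n w

/-- The matrix of `e^{-β (a† a + 1/2)}`; here `β = ħω / k_B T`. -/
def boltzmann (β : ℝ) : Matrix ℕ ℕ ℂ :=
  expMatrix ((-(β : ℂ)) • (number + (1 / 2 : ℂ) • (1 : Module.End ℂ FiniteParticle)))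

end SpinBoson

end

noncomputable section

namespace SpinBoson

open Finset.HasAntidiagonal

/-! ### Words -/

namespace Word

/-! Both sides are expanded over words, and each side assigns to `w` in the limit the Gaussian
moment `p!/2^p` if `p(w) = q(w) = p`, and `0` otherwise; the order of the letters is lost.

Spins: every letter of `w(S₊, S₋)` acts on one site, so the trace moment of `N + 1` spins is a sum
over splittings of `w` between one spin and the other `N` (`eval_collective_succ_apply`). Moments of
the form `a_p (p!)²/2^p` multiply under such splittings by convolution of the weights `a`
(`splitSum_phaseMoment`), i.e. by multiplication of the generating functions `∑ a_n x^n`. One spin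
lies between the weights `1 + x` and `e^x`, hence `N` spins lie between `(1 + x)^N` and `e^{Nx}`
(`totalMoment_bounds`). After division by `N^p` both bounds tend to `p!/2^p`, and the upper one
never exceeds it. This gives the limit for each word and a dominating function for the sum over
words.

Boson: `⟨n|(a†)^p a^p|n⟩` is the falling factorial of `n`, whose mean under the geometric law
`(2/3)(1/3)^n` is `p!/2^p` (`hasSum_thermal_descFactorial`). The Gaussian summability condition
justifies exchanging the sums over words and number states. -/

@[simp] lemma eval_nil {R : Type*} [Monoid R] (x y : R) : eval x y [] = 1 := rfl

@[simp] lemma eval_plus_cons {R : Type*} [Monoid R] (x y : R) (w : Word) :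
    eval x y (Letter.plus :: w) = x * eval x y w := by
  simp [eval]

@[simp] lemma eval_minus_cons {R : Type*} [Monoid R] (x y : R) (w : Word) :
    eval x y (Letter.minus :: w) = y * eval x y w := by
  simp [eval]

@[simp] lemma numPlus_nil : numPlus [] = 0 := rfl

@[simp] lemma numMinus_nil : numMinus [] = 0 := rfl

@[simp] lemma numPlus_plus_cons (w : Word) : numPlus (Letter.plus :: w) = numPlus w + 1 := by
  simp [numPlus]

@[simp] lemma numPlus_minus_cons (w : Word) : numPlus (Letter.minus :: w) = numPlus w := by
  simp [numPlus]

@[simp] lemma numMinus_plus_cons (w : Word) : numMinus (Letter.plus :: w) = numMinus w := by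
  simp [numMinus]

@[simp] lemma numMinus_minus_cons (w : Word) : numMinus (Letter.minus :: w) = numMinus w + 1 := by
  simp [numMinus]

lemma numPlus_add_numMinus (w : Word) : numPlus w + numMinus w = w.length := by
  induction w with
  | nil => rfl
  | cons l w ih => cases l <;> simp <;> omega

lemma eval_smul {R : Type*} [Ring R] [Algebra ℂ R] (c : ℂ) (x y : R) (w : Word) :
    eval (c • x) (c • y) w = c ^ w.length • eval x y w := by
  induction w with
  | nil => simp
  | cons l w ih =>
    cases l <;> simp [ih, pow_succ, smul_smul, mul_comm]

/-- The sum of `F u v` over all ways to split the word `w` into a subword `u` and the complementary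
subword `v`. -/
def splitSum {R : Type*} [Add R] : Word → (Word → Word → R) → R
  | [], F => F [] []
  | l :: w, F => splitSum w (fun u v => F (l :: u) v) + splitSum w (fun u v => F u (l :: v))

lemma splitSum_mono (w : Word) {F G : Word → Word → ℝ} (h : ∀ u v, F u v ≤ G u v) :
    splitSum w F ≤ splitSum w G := by
  induction w generalizing F G with
  | nil => exact h _ _
  | cons l w ih => exact add_le_add (ih fun _ _ => h _ _) (ih fun _ _ => h _ _)

lemma splitSum_mul_left (w : Word) (c : ℂ) (F : Word → Word → ℂ) :
    splitSum w (fun u v => c * F u v) = c * splitSum w F := by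
  induction w generalizing F with
  | nil => rfl
  | cons l w ih => simp only [splitSum, ih, mul_add]

lemma splitSum_sum {ι : Type*} (s : Finset ι) (w : Word) (F : ι → Word → Word → ℂ) :
    splitSum w (fun u v => ∑ i ∈ s, F i u v) = ∑ i ∈ s, splitSum w (F i) := by
  induction w generalizing F with
  | nil => rfl
  | cons l w ih => simp only [splitSum, ih, Finset.sum_add_distrib]

lemma splitSum_ofReal (w : Word) (F : Word → Word → ℝ) :
    splitSum w (fun u v => (F u v : ℂ)) = (splitSum w F : ℝ) := by
  induction w generalizing F with
  | nil => rfl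
  | cons l w ih => simp only [splitSum, ih, Complex.ofReal_add]

/-- A splitting sum that depends only on the numbers of letters is a binomial sum. -/
lemma splitSum_eq_sum_antidiagonal (w : Word) (F : ℕ → ℕ → ℕ → ℕ → ℝ) :
    splitSum w (fun u v => F u.numPlus v.numPlus u.numMinus v.numMinus) =
      ∑ ij ∈ antidiagonal w.numPlus, (w.numPlus.choose ij.1 : ℝ) *
        ∑ kl ∈ antidiagonal w.numMinus, (w.numMinus.choose kl.1 : ℝ) *
          F ij.1 ij.2 kl.1 kl.2 := by
  induction w generalizing F with
  | nil => simp [splitSum]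
  | cons l w ih =>
    cases l with
    | plus =>
      simp only [splitSum, numPlus_plus_cons, numMinus_plus_cons]
      rw [ih (fun i j k l => F (i + 1) j k l), ih (fun i j k l => F i (j + 1) k l),
        Finset.sum_antidiagonal_choose_succ_mul (fun i j => ∑ kl ∈ antidiagonal (numMinus w),
          ((numMinus w).choose kl.1 : ℝ) * F i j kl.1 kl.2), add_comm]
      congr 1
      refine Finset.sum_congr rfl fun ij hij => ?_
      -- Pascal's recursion leaves one of its two sums with the binomial coefficient indexed by the
      -- second component.
      rw [Nat.choose_symm_of_eq_add (mem_antidiagonal.mp hij).symm]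
    | minus =>
      simp only [splitSum, numPlus_minus_cons, numMinus_minus_cons]
      rw [ih (fun i j k l => F i j (k + 1) l), ih (fun i j k l => F i j k (l + 1)),
        ← Finset.sum_add_distrib]
      refine Finset.sum_congr rfl fun ij _ => ?_
      rw [Finset.sum_antidiagonal_choose_succ_mul (fun k l => F ij.1 ij.2 k l), ← mul_add, add_comm]
      congr 2
      refine Finset.sum_congr rfl fun kl hkl => ?_
      rw [Nat.choose_symm_of_eq_add (mem_antidiagonal.mp hkl).symm]

end Word

/-! ### Moments of phase-invariant variables -/

/-- The mixed moment `⟨z^p z̄^q⟩` of a phase-invariant variable, normalized such that moments of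
independent variables are multiplied by convolution of the weights `a`. -/
def phaseMoment (a : ℕ → ℝ) (p q : ℕ) : ℝ :=
  if p = q then a p * (p.factorial : ℝ) ^ 2 / 2 ^ p else 0

lemma phaseMoment_nonneg {a : ℕ → ℝ} (ha : ∀ n, 0 ≤ a n) (p q : ℕ) : 0 ≤ phaseMoment a p q := by
  unfold phaseMoment
  have := ha p
  split_ifs <;> positivity

/-- Only splittings balanced in both parts survive. With `i + j = p` there are `(p choose i)²` of
them, and `(p choose i)² (i!)² (j!)² = (p!)²`, which is why the normalization carries a squared
factorial. -/
lemma splitSum_phaseMoment (a b : ℕ → ℝ) (w : Word) :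
    w.splitSum (fun u v => phaseMoment a u.numPlus u.numMinus *
        phaseMoment b v.numPlus v.numMinus) =
      phaseMoment (fun n => ∑ ij ∈ antidiagonal n, a ij.1 * b ij.2)
        w.numPlus w.numMinus := by
  rw [w.splitSum_eq_sum_antidiagonal (fun i j k l => phaseMoment a i k * phaseMoment b j l)]
  generalize w.numPlus = p
  generalize w.numMinus = q
  by_cases hpq : p = q
  · subst hpq
    simp only [phaseMoment, if_true]
    rw [Finset.sum_mul, Finset.sum_div]
    refine Finset.sum_congr rfl fun ij hij => ?_
    rw [Finset.sum_eq_single ij]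
    · rw [if_pos rfl, if_pos rfl]
      have h := mem_antidiagonal.mp hij
      have hc := Nat.choose_mul_factorial_mul_factorial (h ▸ Nat.le_add_right ij.1 ij.2 : ij.1 ≤ p)
      have h2 : p - ij.1 = ij.2 := by omega
      rw [h2] at hc
      rw [← hc, ← h]
      push_cast
      rw [pow_add]
      field_simp
    · rintro ⟨k, l⟩ hkl hne
      have h1 := mem_antidiagonal.mp hij
      have h2 := mem_antidiagonal.mp hkl
      rw [if_neg]
      · simp
      · rintro rfl
        exact hne (Prod.ext rfl (by simp only at *; omega))
    · exact fun h => absurd hij h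
  · rw [phaseMoment, if_neg hpq]
    refine Finset.sum_eq_zero fun ij hij => ?_
    rw [Finset.sum_eq_zero, mul_zero]
    intro kl hkl
    have h1 := mem_antidiagonal.mp hij
    have h2 := mem_antidiagonal.mp hkl
    by_cases h : ij.1 = kl.1
    · rw [phaseMoment, phaseMoment, if_neg (show ¬ ij.2 = kl.2 by omega)]
      simp
    · rw [phaseMoment, if_neg h]
      simp

lemma sum_antidiagonal_pow_div_factorial (x y : ℝ) (n : ℕ) :
    ∑ ij ∈ antidiagonal n, x ^ ij.1 / (ij.1.factorial : ℝ) *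
      (y ^ ij.2 / (ij.2.factorial : ℝ)) = (x + y) ^ n / (n.factorial : ℝ) := by
  rw [(Commute.all x y).add_pow', Finset.sum_div]
  refine Finset.sum_congr rfl fun ij hij => ?_
  have h := mem_antidiagonal.mp hij
  have hc := Nat.choose_mul_factorial_mul_factorial (h ▸ Nat.le_add_right ij.1 ij.2 : ij.1 ≤ n)
  have h2 : n - ij.1 = ij.2 := by omega
  rw [h2] at hc
  rw [← hc, nsmul_eq_mul]
  have hpos : (n.choose ij.1 : ℝ) ≠ 0 := by
    exact_mod_cast (Nat.choose_pos (by omega : ij.1 ≤ n)).ne'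
  push_cast
  field_simp

/-! ### A single spin -/

lemma spinPlus_eq : spinPlus = !![0, 1; 0, 0] := by
  ext i j
  fin_cases i <;> fin_cases j <;> simp [spinPlus, spinX, spinY, Complex.ext_iff]; norm_num

lemma spinMinus_eq : spinMinus = !![0, 0; 1, 0] := by
  ext i j
  fin_cases i <;> fin_cases j <;> simp [spinMinus, spinX, spinY, Complex.ext_iff] <;> norm_num

/-- `s₊` and `s₋` are matrix units, so a product of them has entries `0` or `1`. The index equation
is conservation of `S_z`; on the diagonal it forces equal numbers of the two letters. -/
lemma eval_spin_apply (u : Word) (i j : Fin 2) :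
    u.eval spinPlus spinMinus i j = 0 ∨
      (u.eval spinPlus spinMinus i j = 1 ∧ (i : ℕ) + u.numPlus = j + u.numMinus) := by
  induction u generalizing i with
  | nil =>
    by_cases h : i = j
    · subst h; simp
    · simp [h]
  | cons l u ih =>
    have h0 := ih 0
    have h1 := ih 1
    cases l <;> fin_cases i <;>
      simp [spinPlus_eq, spinMinus_eq, Matrix.mul_apply] at h0 h1 ⊢
    · rcases h1 with h | h
      · exact Or.inl h
      · exact Or.inr ⟨h.1, by omega⟩
    · rcases h0 with h | h
      · exact Or.inl h
      · exact Or.inr ⟨h.1, by omega⟩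

/-- The moment `2⁻¹ tr u(s₊, s₋)` of a single spin. -/
def spinMoment (u : Word) : ℝ := (Matrix.trace (u.eval spinPlus spinMinus)).re / 2

lemma trace_eval_spin (u : Word) :
    Matrix.trace (u.eval spinPlus spinMinus) = 2 * (spinMoment u : ℂ) := by
  have h0 := eval_spin_apply u 0 0
  have h1 := eval_spin_apply u 1 1
  unfold spinMoment
  rw [Matrix.trace_fin_two]
  rcases h0 with h0 | ⟨h0, -⟩ <;> rcases h1 with h1 | ⟨h1, -⟩ <;> rw [h0, h1] <;> norm_num

lemma spinMoment_nil : spinMoment [] = 1 := by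
  simp [spinMoment]

lemma spinMoment_nonneg (u : Word) : 0 ≤ spinMoment u := by
  have h0 := eval_spin_apply u 0 0
  have h1 := eval_spin_apply u 1 1
  unfold spinMoment
  rw [Matrix.trace_fin_two]
  rcases h0 with h0 | ⟨h0, -⟩ <;> rcases h1 with h1 | ⟨h1, -⟩ <;> rw [h0, h1] <;> norm_num

lemma spinMoment_eq_zero {u : Word} (hu : u.numPlus ≠ u.numMinus) : spinMoment u = 0 := by
  have h0 := eval_spin_apply u 0 0
  have h1 := eval_spin_apply u 1 1
  unfold spinMoment
  rw [Matrix.trace_fin_two]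
  rcases h0 with h0 | ⟨-, h0⟩
  · rcases h1 with h1 | ⟨-, h1⟩
    · rw [h0, h1]; simp
    · exact absurd (by omega) hu
  · exact absurd (by omega) hu

/-- The leading matrix unit has a single nonzero row, so at most one diagonal entry of the product
survives. -/
lemma spinMoment_cons_le (l : Letter) (u : Word) : spinMoment (l :: u) ≤ 1 / 2 := by
  have h0 := eval_spin_apply u 1 0
  have h1 := eval_spin_apply u 0 1
  unfold spinMoment
  rw [Matrix.trace_fin_two]
  cases l <;> simp only [Word.eval_plus_cons, Word.eval_minus_cons]
  · generalize u.eval spinPlus spinMinus = M at *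
    rcases h0 with h | ⟨h, -⟩ <;> simp [spinPlus_eq, Matrix.mul_apply, h]
  · generalize u.eval spinPlus spinMinus = M at *
    rcases h1 with h | ⟨h, -⟩ <;> simp [spinMinus_eq, Matrix.mul_apply, h]

lemma two_pow_le_two_mul_factorial {n : ℕ} (hn : 1 ≤ n) : 2 ^ n ≤ 2 * n.factorial := by
  induction n, hn using Nat.le_induction with
  | base => simp
  | succ n hn ih =>
    rw [Nat.factorial_succ, pow_succ]
    nlinarith [n.factorial_pos]

/-- The weight `1/n!` turns the right side into `n!/2^n`, which is `1` at `n = 0` and at least `1/2`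
for `n ≥ 1`. -/
lemma spinMoment_le (u : Word) :
    spinMoment u ≤ phaseMoment (fun n => 1 ^ n / (n.factorial : ℝ)) u.numPlus u.numMinus := by
  by_cases hu : u.numPlus = u.numMinus
  · cases u with
    | nil => simp [spinMoment_nil, phaseMoment]
    | cons l u =>
      refine (spinMoment_cons_le l u).trans ?_
      have hlen := Word.numPlus_add_numMinus (l :: u)
      rw [List.length_cons] at hlen
      rw [phaseMoment, if_pos hu]
      generalize Word.numPlus (l :: u) = n at *
      have hn : (2 : ℝ) ^ n ≤ 2 * n.factorial := by
        exact_mod_cast two_pow_le_two_mul_factorial (n := n) (by omega)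
      have hf : (0 : ℝ) < n.factorial := by exact_mod_cast n.factorial_pos
      rw [one_pow, div_le_div_iff₀ (by norm_num) (by positivity)]
      have : 1 / (n.factorial : ℝ) * (n.factorial : ℝ) ^ 2 = n.factorial := by field_simp
      rw [this]
      linarith
  · rw [spinMoment_eq_zero hu, phaseMoment, if_neg hu]

/-- The weight `1 + x` is exact on words of at most two letters: both `s₊s₋` and `s₋s₊` have moment
`1/2`. Longer balanced words have at least two raising letters and get weight `0`. -/
lemma le_spinMoment (u : Word) :
    phaseMoment (fun n => (Nat.choose 1 n : ℝ)) u.numPlus u.numMinus ≤ spinMoment u := by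
  by_cases hu : u.numPlus = u.numMinus
  · have hlen := u.numPlus_add_numMinus
    match u with
    | [] => simp [spinMoment_nil, phaseMoment]
    | [l] => simp at hlen; omega
    | [l, l'] =>
      cases l <;> cases l' <;> simp at hu <;>
        simp [phaseMoment, spinMoment, Matrix.trace_fin_two, spinPlus_eq, spinMinus_eq]
    | l :: l' :: l'' :: u =>
      rw [phaseMoment, if_pos hu, Nat.choose_eq_zero_of_lt]
      · simpa using spinMoment_nonneg _
      · simp only [List.length_cons] at hlen
        omega
  · rw [spinMoment_eq_zero hu, phaseMoment, if_neg hu]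

/-! ### `N` spins -/

/-- The moment `2^{-N} tr w(S₊, S₋)` of `N` spins, by recursion on `N`. -/
def totalMoment : ℕ → Word → ℝ
  | 0, w => if w = [] then 1 else 0
  | N + 1, w => w.splitSum fun u v => spinMoment u * totalMoment N v

/-- Induction on `N`: nonnegative one-spin bounds multiply through the splitting sum. Vandermonde's
identity convolves the lower weights, the binomial theorem the upper ones. -/
lemma totalMoment_bounds (N : ℕ) (w : Word) :
    phaseMoment (fun n => (N.choose n : ℝ)) w.numPlus w.numMinus ≤ totalMoment N w ∧
      totalMoment N w ≤
        phaseMoment (fun n => (N : ℝ) ^ n / (n.factorial : ℝ)) w.numPlus w.numMinus := by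
  induction N generalizing w with
  | zero =>
    cases w with
    | nil => simp [phaseMoment, totalMoment]
    | cons l w =>
      simp only [totalMoment, reduceCtorEq, if_false]
      refine ⟨?_, phaseMoment_nonneg (fun n => by positivity) _ _⟩
      rw [phaseMoment]
      split_ifs with h
      · have hlen := Word.numPlus_add_numMinus (l :: w)
        rw [List.length_cons] at hlen
        rw [Nat.choose_eq_zero_of_lt (by omega)]
        simp
      · rfl
  | succ N ih =>
    constructor
    · have h : (fun n => ((N + 1).choose n : ℝ)) = fun n => ∑ ij ∈ antidiagonal n,
          (Nat.choose 1 ij.1 : ℝ) * (N.choose ij.2 : ℝ) := by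
        funext n
        rw [add_comm, Nat.add_choose_eq]
        push_cast
        rfl
      rw [h, ← splitSum_phaseMoment (fun n => (Nat.choose 1 n : ℝ)) (fun n => (N.choose n : ℝ)),
        totalMoment]
      exact w.splitSum_mono fun u v => mul_le_mul (le_spinMoment u) (ih v).1
        (phaseMoment_nonneg (fun n => by positivity) _ _) (spinMoment_nonneg u)
    · have h : (fun n => ((N + 1 : ℕ) : ℝ) ^ n / (n.factorial : ℝ)) =
          fun n => ∑ ij ∈ antidiagonal n,
            1 ^ ij.1 / (ij.1.factorial : ℝ) * ((N : ℝ) ^ ij.2 / (ij.2.factorial : ℝ)) := by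
        funext n
        rw [sum_antidiagonal_pow_div_factorial, add_comm]
        push_cast
        rfl
      rw [h, ← splitSum_phaseMoment (fun n => 1 ^ n / (n.factorial : ℝ))
        (fun n => (N : ℝ) ^ n / (n.factorial : ℝ)), totalMoment]
      exact w.splitSum_mono fun u v => mul_le_mul (spinMoment_le u) (ih v).2
        ((phaseMoment_nonneg (fun n => by positivity) _ _).trans (ih v).1)
        (phaseMoment_nonneg (fun n => by positivity) _ _)

/-- The sum over the sites of a one-site operator. -/
def collective (N : ℕ) (A : Matrix (Fin 2) (Fin 2) ℂ) : SpinOp N := ∑ k : Fin N, atSite k A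

lemma atSite_apply {N : ℕ} (k : Fin N) (A : Matrix (Fin 2) (Fin 2) ℂ) (σ τ : Fin N → Fin 2) :
    atSite k A σ τ = if ∀ j, j ≠ k → σ j = τ j then A (σ k) (τ k) else 0 := by
  simp only [atSite, Matrix.of_apply]
  rw [Finset.prod_ite_zero]
  simp

lemma collective_succ_apply (N : ℕ) (A : Matrix (Fin 2) (Fin 2) ℂ) (a b : Fin 2)
    (σ τ : Fin N → Fin 2) :
    collective (N + 1) A (Fin.cons a σ : Fin (N + 1) → Fin 2)
        (Fin.cons b τ : Fin (N + 1) → Fin 2) =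
      (if σ = τ then A a b else 0) + if a = b then collective N A σ τ else 0 := by
  simp only [collective, Matrix.sum_apply, Fin.sum_univ_succ, atSite_apply, Fin.forall_fin_succ,
    Fin.cons_zero, Fin.cons_succ]
  congr 1
  · simp [funext_iff]
  · by_cases h : a = b <;> simp [h, Fin.ext_iff]

lemma collective_succ_mul_apply (N : ℕ) (A : Matrix (Fin 2) (Fin 2) ℂ) (M : SpinOp (N + 1))
    (a : Fin 2) (σ : Fin N → Fin 2) (ρ : Fin (N + 1) → Fin 2) :
    (collective (N + 1) A * M) (Fin.cons a σ : Fin (N + 1) → Fin 2) ρ =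
      ∑ c, A a c * M (Fin.cons c σ : Fin (N + 1) → Fin 2) ρ +
        ∑ τ, collective N A σ τ * M (Fin.cons a τ : Fin (N + 1) → Fin 2) ρ := by
  rw [Matrix.mul_apply, ← (Fin.consEquiv fun _ : Fin (N + 1) => Fin 2).sum_comp,
    Fintype.sum_prod_type]
  change ∑ c : Fin 2, ∑ τ : Fin N → Fin 2,
    collective (N + 1) A (Fin.cons a σ : Fin (N + 1) → Fin 2)
      (Fin.cons c τ : Fin (N + 1) → Fin 2) * M (Fin.cons c τ : Fin (N + 1) → Fin 2) ρ = _
  simp only [collective_succ_apply, add_mul, Finset.sum_add_distrib, ite_mul,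
    zero_mul, Finset.sum_ite_eq, Finset.mem_univ, if_true]
  congr 1
  rw [Finset.sum_comm]
  simp

/-- A collective operator is `A ⊗ 1 + 1 ⊗ A'`, the first spin plus the rest. The two summands act on
different factors, so each choice of summand for every letter gives a tensor product of two subwords
in their original order. -/
lemma eval_collective_succ_apply (N : ℕ) (A B : Matrix (Fin 2) (Fin 2) ℂ) (w : Word)
    (a b : Fin 2) (σ τ : Fin N → Fin 2) :
    w.eval (collective (N + 1) A) (collective (N + 1) B) (Fin.cons a σ : Fin (N + 1) → Fin 2)
        (Fin.cons b τ : Fin (N + 1) → Fin 2) =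
      w.splitSum fun u v => u.eval A B a b * v.eval (collective N A) (collective N B) σ τ := by
  induction w generalizing a σ with
  | nil =>
    simp only [Word.eval_nil, Word.splitSum, Matrix.one_apply]
    by_cases h : a = b <;> by_cases h' : σ = τ <;> simp [h, h', Fin.cons_inj]
  | cons l w ih =>
    cases l <;>
    · simp only [Word.splitSum, Word.eval_plus_cons, Word.eval_minus_cons]
      rw [collective_succ_mul_apply]
      simp only [ih, Matrix.mul_apply, Finset.sum_mul, Finset.mul_sum, Word.splitSum_sum]
      congr 1 <;>
      · refine Finset.sum_congr rfl fun c _ => ?_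
        rw [← Word.splitSum_mul_left]
        congr 1
        funext u v
        ring

lemma trace_eval_total (N : ℕ) (w : Word) :
    Matrix.trace (w.eval (totalPlus N) (totalMinus N)) = 2 ^ N * (totalMoment N w : ℂ) := by
  change Matrix.trace (w.eval (collective N spinPlus) (collective N spinMinus)) = _
  induction N generalizing w with
  | zero =>
    cases w with
    | nil => simp [totalMoment]
    | cons l w => cases l <;> simp [totalMoment, collective]
  | succ N ih =>
    rw [Matrix.trace, ← (Fin.consEquiv fun _ : Fin (N + 1) => Fin 2).sum_comp,
      Fintype.sum_prod_type]
    change ∑ c : Fin 2, ∑ τ : Fin N → Fin 2,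
      w.eval (collective (N + 1) spinPlus) (collective (N + 1) spinMinus)
        (Fin.cons c τ : Fin (N + 1) → Fin 2) (Fin.cons c τ : Fin (N + 1) → Fin 2) = _
    simp only [eval_collective_succ_apply,
      ← Word.splitSum_sum, ← Finset.mul_sum, ← Finset.sum_mul]
    rw [totalMoment, ← Word.splitSum_ofReal, ← Word.splitSum_mul_left]
    congr 1
    funext u v
    have h1 := trace_eval_spin u
    have h2 := ih v
    simp only [Matrix.trace, Matrix.diag_apply] at h1 h2
    rw [h1, h2]
    push_cast
    ring

open Filter Topology

/-! ### Convergence of the series of `f` at matrices -/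

lemma norm_eval_matrix_le {n : Type*} [Fintype n] [DecidableEq n] {A B : Matrix n n ℂ} {K : ℝ}
    (hA : ∀ i j, ‖A i j‖ ≤ K) (hB : ∀ i j, ‖B i j‖ ≤ K) (w : Word) (i j : n) :
    ‖w.eval A B i j‖ ≤ (Fintype.card n * K) ^ w.length := by
  have hK : 0 ≤ K := (norm_nonneg _).trans (hA i i)
  induction w generalizing i with
  | nil =>
    rw [Word.eval_nil, Matrix.one_apply]
    split_ifs <;> simp
  | cons l w ih =>
    have key : ∀ M : Matrix n n ℂ, (∀ i j, ‖M i j‖ ≤ K) →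
        ‖(M * Word.eval A B w) i j‖ ≤ (Fintype.card n * K) ^ (l :: w).length := by
      intro M hM
      rw [Matrix.mul_apply, List.length_cons, pow_succ', mul_assoc]
      refine (norm_sum_le _ _).trans ((Finset.sum_le_card_nsmul _ _
        (K * (Fintype.card n * K) ^ w.length) fun k _ => ?_).trans ?_)
      · rw [norm_mul]
        exact mul_le_mul (hM i k) (ih k) (norm_nonneg _) hK
      · rw [nsmul_eq_mul, Finset.card_univ]
    cases l
    · rw [Word.eval_plus_cons]
      exact key A hA
    · rw [Word.eval_minus_cons]
      exact key B hB

lemma NCSeries.WellBehaved.summable_term_matrix {f : NCSeries} (hf : f.WellBehaved) {n : Type*}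
    [Fintype n] [DecidableEq n] (A B : Matrix n n ℂ) : Summable (f.term A B) := by
  obtain ⟨K, hK0, hA, hB⟩ : ∃ K : ℝ, 0 ≤ K ∧ (∀ i j, ‖A i j‖ ≤ K) ∧ ∀ i j, ‖B i j‖ ≤ K := by
    refine ⟨∑ i, ∑ j, (‖A i j‖ + ‖B i j‖), by positivity, fun i j => ?_, fun i j => ?_⟩
    all_goals
      refine le_trans ?_ ((Finset.single_le_sum (f := fun j => ‖A i j‖ + ‖B i j‖)
        (fun k _ => by positivity) (Finset.mem_univ j)).trans
        (Finset.single_le_sum (f := fun i => ∑ j, (‖A i j‖ + ‖B i j‖))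
        (fun k _ => by positivity) (Finset.mem_univ i)))
      simp
  refine Pi.summable.mpr fun i => Pi.summable.mpr fun j => ?_
  refine Summable.of_norm_bounded (hf.entire (Fintype.card n * K) (by positivity)) fun w => ?_
  change ‖f w * w.eval A B i j‖ ≤ _
  rw [norm_mul]
  exact mul_le_mul_of_nonneg_left (norm_eval_matrix_le hA hB w i j) (norm_nonneg _)

/-! ### The limit of the spin moments -/

/-- The Gaussian moment `(2/π) ∫ z^p z̄^q e^{-2|z|²} d²z` of a word. -/
def gaussianMoment (w : Word) : ℝ :=
  if w.numPlus = w.numMinus then (w.numPlus.factorial : ℝ) / 2 ^ w.numPlus else 0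

lemma NCSeries.WellBehaved.summable_gaussian {f : NCSeries} (hf : f.WellBehaved) :
    Summable fun w => ‖f w‖ * gaussianMoment w := by
  simpa only [gaussianMoment, mul_ite, mul_zero] using hf.gaussian

/-- The normalized moment `2^{-N} tr w(S₊/√N, S₋/√N)`. -/
def scaledMoment (N : ℕ) (w : Word) : ℝ := (√(N : ℝ))⁻¹ ^ w.length * totalMoment N w

lemma trace_eval_scaled (N : ℕ) (w : Word) :
    Matrix.trace (infiniteTemperatureState N * w.eval (scaledPlus N) (scaledMinus N)) =
      (scaledMoment N w : ℂ) := by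
  rw [infiniteTemperatureState, scaledPlus, scaledMinus, Word.eval_smul, smul_mul_assoc, one_mul,
    Matrix.trace_smul, Matrix.trace_smul, trace_eval_total, scaledMoment]
  simp only [smul_eq_mul]
  push_cast
  field_simp

lemma inv_sqrt_pow_length {w : Word} (hw : w.numPlus = w.numMinus) (N : ℕ) :
    (√(N : ℝ))⁻¹ ^ w.length = ((N : ℝ)⁻¹) ^ w.numPlus := by
  rw [← w.numPlus_add_numMinus, ← hw, ← two_mul, pow_mul, inv_pow,
    Real.sq_sqrt (Nat.cast_nonneg N)]

lemma scaledMoment_nonneg (N : ℕ) (w : Word) : 0 ≤ scaledMoment N w :=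
  mul_nonneg (by positivity)
    ((phaseMoment_nonneg (fun n => by positivity) _ _).trans (totalMoment_bounds N w).1)

lemma totalMoment_eq_zero {w : Word} (hw : w.numPlus ≠ w.numMinus) (N : ℕ) :
    totalMoment N w = 0 := by
  have h := totalMoment_bounds N w
  simp only [phaseMoment, if_neg hw] at h
  exact le_antisymm h.2 h.1

/-- Uniformity in `N` makes the Gaussian moment the dominating function for the sum over words. -/
lemma scaledMoment_le (N : ℕ) (w : Word) : scaledMoment N w ≤ gaussianMoment w := by
  by_cases hw : w.numPlus = w.numMinus
  · have h := (totalMoment_bounds N w).2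
    rw [phaseMoment, if_pos hw] at h
    rw [scaledMoment, inv_sqrt_pow_length hw, gaussianMoment, if_pos hw]
    refine (mul_le_mul_of_nonneg_left h (by positivity)).trans ?_
    generalize w.numPlus = n
    -- Only an inequality, so that `N = 0` is covered, where the product vanishes for `n > 0`.
    have h1 : ((N : ℝ)⁻¹) ^ n * (N : ℝ) ^ n ≤ 1 := by
      rw [← mul_pow]
      exact pow_le_one₀ (by positivity) inv_mul_le_one
    calc ((N : ℝ)⁻¹) ^ n * ((N : ℝ) ^ n / n.factorial * (n.factorial : ℝ) ^ 2 / 2 ^ n)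
        = (((N : ℝ)⁻¹) ^ n * (N : ℝ) ^ n) * ((n.factorial : ℝ) / 2 ^ n) := by
          have : (n.factorial : ℝ) ≠ 0 := by positivity
          generalize ((N : ℝ)⁻¹) ^ n = y
          field_simp
      _ ≤ 1 * ((n.factorial : ℝ) / 2 ^ n) := by gcongr
      _ = _ := one_mul _
  · rw [scaledMoment, totalMoment_eq_zero hw, mul_zero, gaussianMoment, if_neg hw]

lemma tendsto_scaledMoment (w : Word) :
    Tendsto (fun N => scaledMoment N w) atTop (𝓝 (gaussianMoment w)) := by
  by_cases hw : w.numPlus = w.numMinus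
  · refine tendsto_of_tendsto_of_tendsto_of_le_of_le (g := fun N : ℕ =>
      (N.choose w.numPlus * ((N : ℝ)⁻¹) ^ w.numPlus) *
        ((w.numPlus.factorial : ℝ) ^ 2 / 2 ^ w.numPlus)) ?_ tendsto_const_nhds (fun N => ?_)
      (fun N => scaledMoment_le N w)
    -- The limit `(N choose p) N^{-p} → 1/p!` is the Poisson limit with success probability `1/N`,
    -- of rate `1`.
    · have h1 : Tendsto (fun n : ℕ => (n : ℝ) * (n : ℝ)⁻¹) atTop (𝓝 1) := by
        refine tendsto_const_nhds.congr' ?_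
        filter_upwards [eventually_ge_atTop 1] with n hn
        rw [mul_inv_cancel₀ (by positivity)]
      have h2 := (ProbabilityTheory.tendsto_choose_mul_pow_atTop w.numPlus h1).mul_const
        ((w.numPlus.factorial : ℝ) ^ 2 / 2 ^ w.numPlus)
      convert h2 using 2
      rw [gaussianMoment, if_pos hw]
      field_simp
      simp
    · have h := (totalMoment_bounds N w).1
      rw [phaseMoment, if_pos hw] at h
      rw [scaledMoment, inv_sqrt_pow_length hw]
      refine le_trans (le_of_eq ?_) (mul_le_mul_of_nonneg_left h (by positivity))
      ring
  · simp only [scaledMoment, totalMoment_eq_zero hw, mul_zero, gaussianMoment, if_neg hw]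
    exact tendsto_const_nhds

/-! ### Passage to the limit under the sum over words -/

lemma trace_eval_scaled_eq_tsum {f : NCSeries} (hf : f.WellBehaved) (N : ℕ) :
    Matrix.trace (infiniteTemperatureState N * f.eval (scaledPlus N) (scaledMinus N)) =
      ∑' w, f w * (scaledMoment N w : ℂ) := by
  let φ : SpinOp N →+ ℂ :=
    (Matrix.traceAddMonoidHom _ ℂ).comp (AddMonoidHom.mulLeft (infiniteTemperatureState N))
  have hφ : Continuous φ :=
    Continuous.matrix_trace (continuous_const.matrix_mul continuous_id)
  have h := (hf.summable_term_matrix (scaledPlus N) (scaledMinus N)).map_tsum φ hφ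
  refine h.trans (tsum_congr fun w => ?_)
  change Matrix.trace (infiniteTemperatureState N * (f w • w.eval _ _)) = _
  rw [mul_smul_comm, Matrix.trace_smul, trace_eval_scaled, smul_eq_mul]

lemma tendsto_trace_eval_scaled {f : NCSeries} (hf : f.WellBehaved) :
    Tendsto (fun N : ℕ => Matrix.trace (infiniteTemperatureState N *
      f.eval (scaledPlus N) (scaledMinus N))) atTop (𝓝 (∑' w, f w * (gaussianMoment w : ℂ))) := by
  simp only [trace_eval_scaled_eq_tsum hf]
  refine tendsto_tsum_of_dominated_convergence hf.summable_gaussian (fun w => ?_)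
    (Eventually.of_forall fun N w => ?_)
  · exact ((Complex.continuous_ofReal.tendsto _).comp (tendsto_scaledMoment w)).const_mul _
  · rw [norm_mul, Complex.norm_real, Real.norm_of_nonneg (scaledMoment_nonneg N w)]
    exact mul_le_mul_of_nonneg_left (scaledMoment_le N w) (norm_nonneg _)

/-! ### The bosonic mode -/

lemma annihilation_single (n : ℕ) (c : ℂ) :
    annihilation (Finsupp.single n c) = Finsupp.single (n - 1) (c * (√(n : ℝ) : ℝ)) := by
  simp [annihilation]

lemma creation_single (n : ℕ) (c : ℂ) :
    creation (Finsupp.single n c) = Finsupp.single (n + 1) (c * (√((n : ℝ) + 1) : ℝ)) := by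
  simp [creation]

/-- For `q > n` the truncated index `n - q` is harmless, since the falling factorial is then `0`. -/
lemma annihilation_pow_single (q n : ℕ) :
    (annihilation ^ q) (Finsupp.single n 1) =
      Finsupp.single (n - q) ((√(n.descFactorial q : ℝ) : ℝ) : ℂ) := by
  induction q with
  | zero => simp
  | succ q ih =>
    rw [pow_succ', Module.End.mul_apply, ih, annihilation_single, Nat.descFactorial_succ,
      ← Complex.ofReal_mul, ← Real.sqrt_mul (by positivity), Nat.sub_sub]
    push_cast
    rw [mul_comm]

lemma creation_pow_single (p n : ℕ) (c : ℂ) :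
    (creation ^ p) (Finsupp.single n c) =
      Finsupp.single (n + p) (c * (√((n + 1).ascFactorial p : ℝ) : ℝ)) := by
  induction p with
  | zero => simp
  | succ p ih =>
    rw [pow_succ', Module.End.mul_apply, ih, creation_single, Nat.ascFactorial_succ, mul_assoc,
      ← Complex.ofReal_mul, ← Real.sqrt_mul (by positivity), add_assoc]
    congr 4
    push_cast
    ring_nf

lemma matrixElements_normalOrderWord (w : Word) (m n : ℕ) :
    matrixElements (normalOrderWord w) m n = if n - w.numMinus + w.numPlus = m then
      ((√(n.descFactorial w.numMinus : ℝ) *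
        √((n - w.numMinus + 1).ascFactorial w.numPlus : ℝ) : ℝ) : ℂ) else 0 := by
  rw [matrixElements, Matrix.of_apply, normalOrderWord, Module.End.mul_apply,
    annihilation_pow_single, creation_pow_single, Finsupp.single_apply, Complex.ofReal_mul]

/-- The bound does not depend on `w`, so absolute summability of the coefficients alone makes the
matrix elements converge. -/
lemma norm_matrixElements_normalOrderWord_le (w : Word) (m n : ℕ) :
    ‖matrixElements (normalOrderWord w) m n‖ ≤ √(n.factorial : ℝ) * √(m.factorial : ℝ) := by
  rw [matrixElements_normalOrderWord]
  split_ifs with h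
  · rw [Complex.norm_real, Real.norm_of_nonneg (by positivity)]
    refine mul_le_mul (Real.sqrt_le_sqrt ?_) (Real.sqrt_le_sqrt ?_) (by positivity) (by positivity)
    · by_cases hq : w.numMinus ≤ n
      · exact_mod_cast Nat.le_of_dvd n.factorial_pos ⟨_, by
          rw [mul_comm, Nat.factorial_mul_descFactorial hq]⟩
      · rw [Nat.descFactorial_of_lt (by omega)]
        simp
    · rw [← h, ← Nat.factorial_mul_ascFactorial]
      exact_mod_cast Nat.le_mul_of_pos_left _ (Nat.factorial_pos _)
  · rw [norm_zero]
    positivity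

lemma NCSeries.WellBehaved.summable_normalOrderTerm {f : NCSeries} (hf : f.WellBehaved) (m n : ℕ) :
    Summable (normalOrderTerm f m n) := by
  have h := (hf.entire 1 zero_le_one).mul_right (√(n.factorial : ℝ) * √(m.factorial : ℝ))
  simp only [one_pow, mul_one] at h
  refine Summable.of_norm_bounded h fun w => ?_
  rw [normalOrderTerm, norm_mul]
  exact mul_le_mul_of_nonneg_left (norm_matrixElements_normalOrderWord_le w m n) (norm_nonneg _)

lemma matrixElements_normalOrderWord_self (w : Word) (n : ℕ) :
    matrixElements (normalOrderWord w) n n =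
      if w.numPlus = w.numMinus then (n.descFactorial w.numPlus : ℂ) else 0 := by
  rw [matrixElements_normalOrderWord]
  by_cases hq : w.numMinus ≤ n
  · by_cases hw : w.numPlus = w.numMinus
    · rw [if_pos (by omega), if_pos hw, hw]
      have h : (n - w.numMinus + 1).ascFactorial w.numMinus = n.descFactorial w.numMinus := by
        apply Nat.eq_of_mul_eq_mul_left (n - w.numMinus).factorial_pos
        rw [Nat.factorial_mul_ascFactorial, Nat.factorial_mul_descFactorial hq,
          Nat.sub_add_cancel hq]
      rw [h, Real.mul_self_sqrt (by positivity)]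
      simp
    · rw [if_neg (by omega), if_neg hw]
  · rw [Nat.descFactorial_of_lt (by omega)]
    by_cases hw : w.numPlus = w.numMinus
    · rw [hw, Nat.descFactorial_of_lt (by omega)]
      simp
    · simp [hw]

lemma number_single (n : ℕ) : number (Finsupp.single n 1) = Finsupp.single n (n : ℂ) := by
  cases n with
  | zero => simp [number, annihilation_single]
  | succ n =>
    rw [number, Module.End.mul_apply, annihilation_single, creation_single]
    simp only [Nat.add_sub_cancel, one_mul, Nat.cast_add, Nat.cast_one]
    rw [← Complex.ofReal_mul, Real.mul_self_sqrt (by positivity)]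
    simp

/-- Number states are eigenvectors of the exponent, so the operator exponential reduces to the
scalar series. -/
lemma boltzmann_apply (β : ℝ) (m n : ℕ) :
    boltzmann β m n = if n = m then Complex.exp (-(β : ℂ) * (n + 1 / 2)) else 0 := by
  have hT : ∀ k : ℕ, (((-(β : ℂ)) • (number + (1 / 2 : ℂ) •
      (1 : Module.End ℂ FiniteParticle))) ^ k) (Finsupp.single n 1) =
        Finsupp.single n ((-(β : ℂ) * (n + 1 / 2)) ^ k) := by
    intro k
    induction k with
    | zero => simp
    | succ k ih =>
      rw [pow_succ, Module.End.mul_apply]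
      have h1 : ((-(β : ℂ)) • (number + (1 / 2 : ℂ) • (1 : Module.End ℂ FiniteParticle)))
          (Finsupp.single n 1) = (-(β : ℂ) * (n + 1 / 2)) • Finsupp.single n 1 := by
        rw [LinearMap.smul_apply, LinearMap.add_apply, LinearMap.smul_apply, number_single,
          Module.End.one_apply, Finsupp.smul_single, ← Finsupp.single_add, Finsupp.smul_single,
          Finsupp.smul_single]
        simp
      rw [h1, map_smul, ih, Finsupp.smul_single, smul_eq_mul, pow_succ']
  simp only [boltzmann, expMatrix, matrixElements, Matrix.of_apply, hT, Finsupp.single_apply]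
  split_ifs with h
  · rw [Complex.exp_eq_exp_ℂ, ← (NormedSpace.expSeries_div_hasSum_exp _).tsum_eq]
    exact tsum_congr fun k => by rw [mul_comm, ← div_eq_mul_inv]
  · simp

/-! ### Thermal expectations at `ħω/k_BT = ln 3` -/

lemma boltzmann_log_three_self (n : ℕ) :
    boltzmann (Real.log 3) n n = (((√3)⁻¹ * (1 / 3) ^ n : ℝ) : ℂ) := by
  rw [boltzmann_apply, if_pos rfl]
  have h : Real.exp (-Real.log 3 * (n + 1 / 2)) = (√3)⁻¹ * (1 / 3) ^ n := by
    rw [Real.sqrt_eq_rpow, ← Real.rpow_neg (by norm_num), ← Real.rpow_natCast,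
      Real.rpow_def_of_pos (by norm_num), Real.rpow_def_of_pos (by norm_num), ← Real.exp_add,
      one_div (3 : ℝ), Real.log_inv]
    congr 1
    ring
  rw [← h]
  push_cast
  rfl

lemma opMul_apply_self_of_diagonal {A : Matrix ℕ ℕ ℂ} (hA : ∀ m n, n ≠ m → A m n = 0)
    (B : Matrix ℕ ℕ ℂ) (n : ℕ) : opMul A B n n = A n n * B n n := by
  rw [opMul, Matrix.of_apply, tsum_eq_single n]
  intro k hk
  rw [hA n k hk, zero_mul]

lemma boltzmann_eq_zero (β : ℝ) {m n : ℕ} (h : n ≠ m) : boltzmann β m n = 0 := by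
  rw [boltzmann_apply, if_neg h]

/-- The factorial moments of the thermal state of mean occupation `1/2`. -/
lemma hasSum_thermal_descFactorial (p : ℕ) :
    HasSum (fun n : ℕ => 2 / 3 * (1 / 3 : ℝ) ^ n * n.descFactorial p)
      ((p.factorial : ℝ) / 2 ^ p) := by
  -- The negative binomial series at `1/3`. The prefactor collects the normalization `2/3`, the
  -- power `(1/3)^p` from shifting `n` by `p`, and the `p!` relating falling factorials to
  -- binomials; the `p` terms dropped by the shift are zero.
  have h := (hasSum_choose_mul_geometric_of_norm_lt_one p
    (by norm_num : ‖(1 / 3 : ℝ)‖ < 1)).mul_left (2 / 3 * (1 / 3) ^ p * (p.factorial : ℝ))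
  have hsum0 : ∑ i ∈ Finset.range p, 2 / 3 * (1 / 3 : ℝ) ^ i * (i.descFactorial p : ℝ) = 0 :=
    Finset.sum_eq_zero fun i hi => by
      rw [Nat.descFactorial_of_lt (Finset.mem_range.mp hi), Nat.cast_zero, mul_zero]
  have hval : 2 / 3 * (1 / 3) ^ p * (p.factorial : ℝ) * (1 / (1 - 1 / 3) ^ (p + 1)) =
      (p.factorial : ℝ) / 2 ^ p := by
    have h3 : (1 - 1 / 3 : ℝ) = 2 / 3 := by norm_num
    rw [h3, pow_succ, div_pow, div_pow, one_pow]
    field_simp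
  rw [← hasSum_nat_add_iff' p, hsum0, sub_zero, ← hval]
  refine h.congr_fun fun n => ?_
  rw [Nat.descFactorial_eq_factorial_mul_choose]
  push_cast
  ring

/-- The expectation of a normal-ordered word in the thermal state of mean occupation `1/2` is its
Gaussian moment. -/
lemma hasSum_thermal_normalOrderWord (w : Word) :
    HasSum (fun n : ℕ => 2 / 3 * (1 / 3 : ℝ) ^ n *
      (if w.numPlus = w.numMinus then (n.descFactorial w.numPlus : ℝ) else 0))
      (gaussianMoment w) := by
  unfold gaussianMoment
  split_ifs
  · exact hasSum_thermal_descFactorial _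
  · simp

lemma two_div_sqrt_mul_boltzmann (n : ℕ) :
    ((2 / √(3 : ℝ) : ℝ) : ℂ) * boltzmann (Real.log 3) n n = ((2 / 3 * (1 / 3) ^ n : ℝ) : ℂ) := by
  rw [boltzmann_log_three_self, ← Complex.ofReal_mul]
  congr 1
  have h : √(3 : ℝ) * √3 = 3 := Real.mul_self_sqrt (by norm_num)
  calc 2 / √(3 : ℝ) * ((√3)⁻¹ * (1 / 3) ^ n) = 2 / (√3 * √3) * (1 / 3) ^ n := by field_simp
    _ = _ := by rw [h]

/-- Tonelli: as `g` is nonnegative, summing norms over `n` first gives exactly the Gaussian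
summability condition. -/
lemma summable_thermal {f : NCSeries} (hf : f.WellBehaved) {g : Word → ℕ → ℝ}
    (hg0 : ∀ w n, 0 ≤ g w n) (hg : ∀ w, HasSum (g w) (gaussianMoment w)) :
    Summable fun x : Word × ℕ => f x.1 * (g x.1 x.2 : ℂ) := by
  refine Summable.of_norm ?_
  have hn : (fun x : Word × ℕ => ‖f x.1 * (g x.1 x.2 : ℂ)‖) =
      fun x : Word × ℕ => ‖f x.1‖ * g x.1 x.2 := by
    funext x
    rw [norm_mul, Complex.norm_real, Real.norm_of_nonneg (hg0 _ _)]
  rw [hn, summable_prod_of_nonneg fun x => mul_nonneg (norm_nonneg _) (hg0 _ _)]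
  refine ⟨fun w => (hg w).summable.mul_left ‖f w‖, ?_⟩
  have ht : ∀ w, ∑' n, ‖f w‖ * g w n = ‖f w‖ * gaussianMoment w :=
    fun w => ((hg w).mul_left ‖f w‖).tsum_eq
  simpa only [ht] using hf.summable_gaussian

lemma hasSum_thermal_normalOrder {f : NCSeries} (hf : f.WellBehaved) :
    HasSum (fun n : ℕ => ((2 / 3 * (1 / 3) ^ n : ℝ) : ℂ) * normalOrder f n n)
      (∑' w, f w * (gaussianMoment w : ℂ)) := by
  have hsum := summable_thermal hf (g := fun w n => 2 / 3 * (1 / 3 : ℝ) ^ n *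
    (if w.numPlus = w.numMinus then (n.descFactorial w.numPlus : ℝ) else 0))
    (fun w n => by split_ifs <;> positivity) hasSum_thermal_normalOrderWord
  have htot := hsum.hasSum.prod_fiberwise fun w =>
    (Complex.hasSum_ofReal.mpr (hasSum_thermal_normalOrderWord w)).mul_left (f w)
  rw [htot.tsum_eq]
  -- Fubini: the same double series is now summed over words first, for fixed `n`.
  have hswap := (Equiv.prodComm ℕ Word).hasSum_iff.mpr hsum.hasSum
  refine hswap.prod_fiberwise fun n => ?_
  have h := (hf.summable_normalOrderTerm n n).hasSum.mul_left (((2 / 3 * (1 / 3) ^ n : ℝ) : ℂ))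
  refine h.congr_fun fun w => ?_
  change f w * ((2 / 3 * (1 / 3 : ℝ) ^ n * (if w.numPlus = w.numMinus then
    (n.descFactorial w.numPlus : ℝ) else 0) : ℝ) : ℂ) = _
  rw [normalOrderTerm, matrixElements_normalOrderWord_self]
  by_cases hw : w.numPlus = w.numMinus
  · rw [if_pos hw, if_pos hw]
    push_cast
    ring
  · rw [if_neg hw, if_neg hw]
    simp

end SpinBoson

end

open SpinBoson in
theorem mainTheorem1 (f : SpinBoson.NCSeries) (hf : f.WellBehaved) :
    -- both `f(S₊/√N, S₋/√N)` and `𝒩f(a†, a)` are well defined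
    (∀ N : ℕ, Summable (f.term (SpinBoson.scaledPlus N) (SpinBoson.scaledMinus N))) ∧
    (∀ m n : ℕ, Summable (SpinBoson.normalOrderTerm f m n)) ∧
    -- the trace on the bosonic side exists, and the limit formula holds
    (∃ t : ℂ,
      SpinBoson.HasTrace
        (SpinBoson.opMul (SpinBoson.boltzmann (Real.log 3)) (SpinBoson.normalOrder f)) t ∧
      Filter.Tendsto
        (fun N : ℕ => Matrix.trace (SpinBoson.infiniteTemperatureState N *
          f.eval (SpinBoson.scaledPlus N) (SpinBoson.scaledMinus N)))
        Filter.atTop (nhds (((2 / √(3 : ℝ) : ℝ) : ℂ) * t))) ∧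
    -- `(2/√3) e^{-ln 3 (a†a + 1/2)}` is a normalized thermal state of mean occupation `1/2`
    SpinBoson.HasTrace (((2 / √(3 : ℝ) : ℝ) : ℂ) • SpinBoson.boltzmann (Real.log 3)) 1 ∧
    SpinBoson.HasTrace
      (SpinBoson.opMul (((2 / √(3 : ℝ) : ℝ) : ℂ) • SpinBoson.boltzmann (Real.log 3))
        (SpinBoson.matrixElements SpinBoson.number)) (1 / 2) := by
  have hc : ((2 / √(3 : ℝ) : ℝ) : ℂ) ≠ 0 := by
    rw [Complex.ofReal_ne_zero]
    positivity
  -- The bosonic trace is the Gaussian sum divided by the normalization `2/√3`, which cancels in the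
  -- limit formula.
  refine ⟨fun N => hf.summable_term_matrix _ _, hf.summable_normalOrderTerm,
    ⟨((2 / √(3 : ℝ) : ℝ) : ℂ)⁻¹ * ∑' w, f w * (gaussianMoment w : ℂ), ?_, ?_⟩, ?_, ?_⟩
  · refine ((hasSum_thermal_normalOrder hf).mul_left _).congr_fun fun n => ?_
    rw [opMul_apply_self_of_diagonal (fun _ _ => boltzmann_eq_zero _),
      ← two_div_sqrt_mul_boltzmann, mul_assoc, inv_mul_cancel_left₀ hc]
  · rw [mul_inv_cancel_left₀ hc]
    exact tendsto_trace_eval_scaled hf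
  -- Normalization and mean occupation are the factorial moments of orders `0` and `1`.
  · have h := Complex.hasSum_ofReal.mpr (hasSum_thermal_descFactorial 0)
    simp only [Nat.factorial_zero, pow_zero, Nat.cast_one, div_one, Complex.ofReal_one] at h
    refine h.congr_fun fun n => ?_
    rw [Matrix.smul_apply, smul_eq_mul, two_div_sqrt_mul_boltzmann]
    simp
  · have h := Complex.hasSum_ofReal.mpr (hasSum_thermal_descFactorial 1)
    have h2 : (((Nat.factorial 1 : ℝ) / 2 ^ 1 : ℝ) : ℂ) = 1 / 2 := by simp
    rw [h2] at h
    refine h.congr_fun fun n => ?_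
    rw [opMul_apply_self_of_diagonal fun m n hmn => by
      rw [Matrix.smul_apply, boltzmann_eq_zero _ hmn, smul_zero]]
    rw [Matrix.smul_apply, smul_eq_mul, two_div_sqrt_mul_boltzmann, matrixElements,
      Matrix.of_apply, number_single]
    simp
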